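/- Let $S$ be an infinite set, let $D\ge 1$ be an integer, and let $V=S^D$. For a set $W$ let $\mathcal F(W)$ denote the set of finite subsets of $W$, and write $a+b=a\cup b$. A *set-polynomial* is a mapping $P:\mathcal F(S)\to\mathcal F(V)$ given by coefficients $P_\alpha\in\mathcal F(S^{\bar\alpha})$, $\alpha\subseteq\{1,\dots,D\}$, $\bar\alpha=\{1,\dots,D\}\setminus\alpha$, through $$P(n)=\bigcup_{\alpha\subseteq\{1,\dots,D\}}\{s\in V:\ (s_i)_{i\in\bar\alpha}\in P_\alpha\ \text{and}\ s_i\in n\ \text{for all } i\in\alpha\};$$ its constant term is $P_\emptyset=P(\emptyset)$. (Here $S^{\emptyset}$ is a one-point set.) An *action* of $\mathcal F(V)$ on a topological space $X$ is a mapping $a\mapsto T^a$ from $\mathcal F(V)$ to the continuous self-maps of $X$ such that $T^{a\cup b}=T^aT^b$ whenever $a\cap b=\emptyset$. Let $A$ be a finite set of set-polynomials, all of whose constant terms are empty. Then: 1. $A$ is a system of recurrence: for every compact metric space $(X,\rho)$, every action $T$ of $\mathcal F(V)$ on $X$, every $\varepsilon>0$ and every $H\in\mathcal F(S)$ there exists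 $N\in\mathcal F(S)$ with $N\cap H=\emptyset$ such that for every $x\in X$ there exist a nonempty $n\subseteq N$ and a set $a\subseteq\bigcup_{P\in A}P(N)$ such that, for all $P\in A$, $a\cap P(n)=\emptyset$ and $\rho(T^{a+P(n)}x,T^ax)<\varepsilon$. 2. (Chromatic form.) For every $k\in\mathbb N$ and every $H\in\mathcal F(S)$ there exists $N\in\mathcal F(S)$ with $N\cap H=\emptyset$ such that for every mapping $\omega:\mathcal F(V)\to\{1,\dots,k\}$ there exist a nonempty $n\subseteq N$ and a set $a\subseteq\bigcup_{P\in A}P(N)$ such that, for all $P\in A$, $a\cap P(n)=\emptyset$ and $\omega(a+P(n))=\omega(a)$. -/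

import Mathlib

universe u v

/-- A set-polynomial over `S` in dimension `D`, given by its coefficients: for each `α ⊆ {1, …, D}`
a finite subset of `S ^ ᾱ`, where `ᾱ` is the complement of `α`. -/
@[ext]
structure SetPolynomial (S : Type u) (D : ℕ) where
  coeff : (α : Finset (Fin D)) → Finset ({i : Fin D // i ∉ α} → S)

namespace SetPolynomial

variable {S : Type u} {D : ℕ}

/-- The `α`-term at `n`: the points `s ∈ S ^ D` whose restriction to the complement of `α` belongs
to the coefficient of `α` and whose coordinates in `α` belong to `n`. -/
def term (P : SetPolynomial S D) (α : Finset (Fin D)) (n : Finset S) : Set (Fin D → S) :=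
  {s | (fun i : {i : Fin D // i ∉ α} => s i) ∈ P.coeff α ∧ ∀ i ∈ α, s i ∈ n}

theorem finite_term (P : SetPolynomial S D) (α : Finset (Fin D)) (n : Finset S) :
    (P.term α n).Finite := by
  classical
  refine Set.Finite.of_injOn
    (f := fun s : Fin D → S =>
      ((fun i : {i : Fin D // i ∉ α} => s i), (fun i : {i : Fin D // i ∈ α} => s i)))
    (t := ((P.coeff α : Set _) ×ˢ
      (Fintype.piFinset (fun _ : {i : Fin D // i ∈ α} => n) : Set _))) ?_ ?_ ?_
  · rintro s ⟨h₁, h₂⟩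
    refine ⟨h₁, ?_⟩
    simpa using h₂
  · intro s _ t _ h
    funext i
    simp only [Prod.mk.injEq] at h
    by_cases hi : i ∈ α
    · exact congrFun h.2 ⟨i, hi⟩
    · exact congrFun h.1 ⟨i, hi⟩
  · exact (Finset.finite_toSet _).prod (Finset.finite_toSet _)

/-- The mapping `F(S) → F(S ^ D)` defined by a set-polynomial: the union of all its terms. -/
noncomputable def eval (P : SetPolynomial S D) (n : Finset S) : Finset (Fin D → S) :=
  (Set.finite_iUnion (fun α => P.finite_term α n)).toFinset

theorem mem_eval (P : SetPolynomial S D) (n : Finset S) (s : Fin D → S) :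
    s ∈ P.eval n ↔ ∃ α : Finset (Fin D),
      (fun i : {i : Fin D // i ∉ α} => s i) ∈ P.coeff α ∧ ∀ i ∈ α, s i ∈ n := by
  simp [eval, term]

/-- The constant term of a set-polynomial is empty. -/
def HasEmptyConstantTerm (P : SetPolynomial S D) : Prop :=
  P.coeff ∅ = ∅

end SetPolynomial

open Classical in
/-- An action of `F(W)`, the finite subsets of `W`, on `X` by continuous self-maps:
`T^(a ∪ b) = T^a ∘ T^b` is required for disjoint `a`, `b` only. -/
structure FinsetAction (W : Type u) (X : Type v) [TopologicalSpace X] where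
  act : Finset W → C(X, X)
  act_union : ∀ a b : Finset W, Disjoint a b → act (a ∪ b) = (act a).comp (act b)

open Classical in
/-- A finite system `A` of set-polynomials is a system of recurrence with respect to the
action `T`. -/
def IsRecurrentFor {S : Type u} {D : ℕ} (A : Finset (SetPolynomial S D))
    {X : Type v} [MetricSpace X] (T : FinsetAction (Fin D → S) X) : Prop :=
  ∀ ε : ℝ, 0 < ε → ∀ H : Finset S, ∃ N : Finset S, Disjoint N H ∧
    ∀ x : X, ∃ n : Finset S, n ⊆ N ∧ n.Nonempty ∧
      ∃ a : Finset (Fin D → S), a ⊆ A.biUnion (fun P => P.eval N) ∧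
        ∀ P ∈ A, Disjoint a (P.eval n) ∧
          dist (T.act (a ∪ P.eval n) x) (T.act a x) < ε

/-- A system of recurrence: recurrent for every action of `F(S ^ D)` on every compact metric
space. -/
def IsSystemOfRecurrence {S : Type u} {D : ℕ} (A : Finset (SetPolynomial S D)) : Prop :=
  ∀ (X : Type v) [MetricSpace X] [CompactSpace X] (T : FinsetAction (Fin D → S) X),
    IsRecurrentFor A T

open Classical in
/-- The combinatorial form of recurrence, for colorings of `F(S ^ D)` with `k` colors. -/
def IsColoringRecurrent {S : Type u} {D : ℕ} (A : Finset (SetPolynomial S D)) : Prop :=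
  ∀ (k : ℕ) (H : Finset S), ∃ N : Finset S, Disjoint N H ∧
    ∀ ω : Finset (Fin D → S) → Fin k, ∃ n : Finset S, n ⊆ N ∧ n.Nonempty ∧
      ∃ a : Finset (Fin D → S), a ⊆ A.biUnion (fun P => P.eval N) ∧
        ∀ P ∈ A, Disjoint a (P.eval n) ∧ ω (a ∪ P.eval n) = ω a

/-! ### Words, polynomials acting on words by overwriting, and the weight of a system -/

/-! A subset of a finite piece of `S ^ D` is a word over `{true, false}`, and passing from `a` to `a
+ P(n)` changes only positions that involve a letter of `n`. The chromatic form thus reduces to a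
polynomial Hales–Jewett theorem, `exists_hasMono`, with the constant `false` as reference polynomial
`p₀`: overwriting by it clears the room for every `P(n)`.

That theorem is proved by PET induction combined with color focusing. The weight counts leading
parts relative to `p₀`, degree by degree. Once a block `N` is fixed, adjoining `Γ ⊆ N` to the
argument gives derived polynomials over `M ⊕ N`. A coefficient from `N` costs a variable, so `Γ`
influences only what lies below the leading part. Taking a derived member of minimal degree as the
new reference removes its leading class, and the weight drops (`weight_derivedSystem_lt`).

The induction hypothesis supplies a further block `B`, on which a word is colored by the entire
coloring it induces on words over `M ⊕ N`. This yields one more focused color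
(`hasMono_or_isFocused_succ`), which cannot go on beyond the number of colors. For the topological
form, `a` is colored by a small ball containing `T^a x`. -/

namespace PolyHJ

variable {D : ℕ} {M N A B L : Type*}

/-- The number of variable coordinates of a pattern. -/
noncomputable def deg (v : Fin D → Option M) : ℕ := {i | v i = none}.ncard

theorem deg_le (v : Fin D → Option M) : deg v ≤ D := by
  simpa [deg] using Set.ncard_le_card {i | v i = none}

/-- The pattern of a position: letters of `N` are turned into variables. -/
def erase (s : Fin D → M ⊕ N) : Fin D → Option M :=
  fun i => (s i).elim some (fun _ => none)

/-- Turn the coefficients in `N` of a pattern into variables. -/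
def collapse (v : Fin D → Option (M ⊕ N)) : Fin D → Option M :=
  fun i => (v i).bind (fun x => x.elim some (fun _ => none))

/-- Each coefficient from `N` becomes an additional variable. This strict increase makes the weight
drop: such patterns collapse above the relative degree, where `p` and `p₀` agree. -/
theorem deg_lt_deg_collapse {v : Fin D → Option (M ⊕ N)} {i : Fin D} {b : N}
    (h : v i = some (Sum.inr b)) : deg v < deg (collapse v) := by
  refine Set.ncard_lt_ncard ?_
  refine ⟨fun j hj => ?_, fun hs => ?_⟩
  · simp only [Set.mem_ofPred_eq] at hj ⊢
    simp [collapse, hj]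
  · have : v i = none := hs (by simp [collapse, h])
    simp [h] at this

theorem deg_le_deg_collapse (v : Fin D → Option (M ⊕ N)) : deg v ≤ deg (collapse v) := by
  refine Set.ncard_le_ncard fun j hj => ?_
  simp only [Set.mem_ofPred_eq] at hj ⊢
  simp [collapse, hj]

theorem deg_collapse_of_pure {v : Fin D → Option (M ⊕ N)}
    (h : ∀ i b, v i ≠ some (Sum.inr b)) : deg (collapse v) = deg v := by
  unfold deg
  congr 1
  ext i
  have := h i
  simp only [collapse, Set.mem_ofPred_eq]
  rcases hv : v i with _ | (m | b)
  · simp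
  · simp
  · exact absurd hv (this b)

/-- View a pattern over `M` as a pattern over `M ⊕ N`. -/
def lift (N : Type*) (v : Fin D → Option M) : Fin D → Option (M ⊕ N) :=
  fun i => (v i).map Sum.inl

theorem collapse_lift (v : Fin D → Option M) : collapse (lift N v) = v := by
  funext i
  rcases hv : v i with _ | m <;> simp [collapse, lift, hv]

theorem lift_pure (v : Fin D → Option M) (i : Fin D) (b : N) :
    lift N v i ≠ some (Sum.inr b) := by
  rcases hv : v i with _ | m <;> simp [lift, hv]

theorem deg_lift (v : Fin D → Option M) : deg (lift N v) = deg v := by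
  rw [← deg_collapse_of_pure (lift_pure v), collapse_lift]

open Classical in
/-- Overwrite the word `w` by the polynomial `p` evaluated at `n`: a position with letters in
`M ∪ n`, at least one of them in `n`, receives the letter that `p` gives to its pattern. -/
noncomputable def overwrite (p : (Fin D → Option M) → L) (n : Set N) (w : (Fin D → M ⊕ N) → L) :
    (Fin D → M ⊕ N) → L :=
  fun s => if (∃ i b, s i = Sum.inr b) ∧ ∀ i b, s i = Sum.inr b → b ∈ n then p (erase s) else w s

theorem overwrite_empty (p : (Fin D → Option M) → L) (w : (Fin D → M ⊕ N) → L) :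
    overwrite p ∅ w = w := by
  funext s
  refine if_neg ?_
  rintro ⟨⟨i, b, h⟩, h'⟩
  exact h' i b h

open Classical in
/-- The polynomial obtained from `p` by adjoining `Γ` to its argument, on patterns with
coefficients in `M ∪ Γ`; all other patterns are treated by the reference polynomial `p₀`. -/
noncomputable def derive (p₀ : (Fin D → Option M) → L) (Γ : Set N) (p : (Fin D → Option M) → L) :
    (Fin D → Option (M ⊕ N)) → L :=
  fun v => if ∀ i b, v i = some (Sum.inr b) → b ∈ Γ then p (collapse v) else p₀ (collapse v)

theorem derive_of_pure (p₀ : (Fin D → Option M) → L) (Γ : Set N) (p : (Fin D → Option M) → L)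
    {v : Fin D → Option (M ⊕ N)} (h : ∀ i b, v i ≠ some (Sum.inr b)) :
    derive p₀ Γ p v = p (collapse v) :=
  if_pos fun i b hb => absurd hb (h i b)

theorem derive_self (p₀ : (Fin D → Option M) → L) (Γ : Set N) :
    derive p₀ Γ p₀ = fun v => p₀ (collapse v) := by
  funext v
  exact ite_self _

/-- `e` is the largest degree of a pattern where `p` and `q` differ. -/
def IsRelDeg (p q : (Fin D → Option M) → L) (e : ℕ) : Prop :=
  (∃ v, deg v = e ∧ p v ≠ q v) ∧ ∀ v, e < deg v → p v = q v

theorem IsRelDeg.le {p q : (Fin D → Option M) → L} {e : ℕ} (h : IsRelDeg p q e) : e ≤ D := by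
  obtain ⟨v, rfl, -⟩ := h.1
  exact deg_le v

theorem IsRelDeg.eq {p q : (Fin D → Option M) → L} {e e' : ℕ} (h : IsRelDeg p q e)
    (h' : IsRelDeg p q e') : e = e' := by
  obtain ⟨v, rfl, hv⟩ := h.1
  obtain ⟨v', rfl, hv'⟩ := h'.1
  by_contra hne
  rcases lt_or_gt_of_ne hne with hlt | hlt
  · exact hv' (h.2 _ hlt)
  · exact hv (h'.2 _ hlt)

theorem exists_isRelDeg {p q : (Fin D → Option M) → L} (h : p ≠ q) : ∃ e, IsRelDeg p q e := by
  classical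
  -- Minimizing `D - deg v` maximizes the degree.
  have hex : ∃ m : ℕ, ∃ v, D - deg v = m ∧ p v ≠ q v := by
    obtain ⟨v, hv⟩ := Function.ne_iff.mp h
    exact ⟨_, v, rfl, hv⟩
  obtain ⟨v, hv, hne⟩ := Nat.find_spec hex
  refine ⟨deg v, ⟨v, rfl, hne⟩, fun u hu => ?_⟩
  by_contra hne'
  refine Nat.find_min hex (m := D - deg u) ?_ ⟨u, rfl, hne'⟩
  rw [← hv]
  have := deg_le u
  omega

/-- The leading part in degree `e`: the values on patterns of degree `e`. -/
def leading (e : ℕ) (p : (Fin D → Option M) → L) : {v : Fin D → Option M // deg v = e} → L :=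
  fun v => p v

/-- The number of leading parts of the members of degree `e` relative to `q`, for all `e`. -/
noncomputable def weight (𝒜 : Set ((Fin D → Option M) → L)) (q : (Fin D → Option M) → L) :
    Fin (D + 1) → ℕ :=
  fun e => (leading (e : ℕ) '' {p ∈ 𝒜 | IsRelDeg p q e}).ncard

/-- Weights are compared at the highest degree where they differ. -/
def WeightLT (x y : Fin (D + 1) → ℕ) : Prop :=
  Pi.Lex (· > ·) (fun {_} => (· < ·)) x y

theorem wellFounded_weightLT : WellFounded (WeightLT (D := D)) :=
  Pi.Lex.wellFounded _ fun _ => wellFounded_lt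

/-- Coordinates below `i` are unconstrained: the derived system may have many more leading parts in
low degrees. -/
theorem weightLT_of_le {x y : Fin (D + 1) → ℕ} (i : Fin (D + 1)) (h : ∀ j, i < j → x j ≤ y j)
    (hi : x i < y i) : WeightLT x y := by
  classical
  obtain ⟨j, hj, hmax⟩ := (Finset.univ.filter fun j => i ≤ j ∧ x j < y j).exists_max_image id
    ⟨i, by simpa using hi⟩
  simp only [Finset.mem_filter, Finset.mem_univ, true_and, id_eq] at hj hmax
  refine ⟨j, fun l hl => ?_, hj.2⟩
  have hil : i < l := lt_of_le_of_lt hj.1 hl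
  refine le_antisymm (h l hil) ?_
  by_contra hlt
  exact absurd (hmax l ⟨hil.le, not_le.mp hlt⟩) (not_le.mpr hl)

/-- The system derived from `𝒜` by adjoining subsets of `N` to the argument. -/
def derivedSystem (N : Type*) (p₀ : (Fin D → Option M) → L) (𝒜 : Set ((Fin D → Option M) → L)) :
    Set ((Fin D → Option (M ⊕ N)) → L) :=
  {r | ∃ Γ : Set N, ∃ p ∈ 𝒜, p ≠ p₀ ∧ r = derive p₀ Γ p}

/-! ### Descent of the weight under derivation -/

section Weight

variable {p₀ p p₁ : (Fin D → Option M) → L} {e e₁ : ℕ}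

theorem derive_of_lt_deg (Γ : Set N) (hp : IsRelDeg p p₀ e) {v : Fin D → Option (M ⊕ N)}
    (hv : e < deg v) : derive p₀ Γ p v = p₀ (collapse v) := by
  have := hp.2 _ (hv.trans_le (deg_le_deg_collapse v))
  unfold derive
  split_ifs
  · exact this
  · rfl

theorem derive_of_not_pure (Γ : Set N) (hp : IsRelDeg p p₀ e) {v : Fin D → Option (M ⊕ N)}
    (hv : deg v = e) {i : Fin D} {b : N} (hb : v i = some (Sum.inr b)) :
    derive p₀ Γ p v = p₀ (collapse v) := by
  have := hp.2 (collapse v) (hv ▸ deg_lt_deg_collapse hb)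
  unfold derive
  split_ifs
  · exact this
  · rfl

open Classical in
/-- The leading part of a derived polynomial in terms of the leading part of the original. -/
noncomputable def liftLeading (N : Type*) (p₀ : (Fin D → Option M) → L) (e : ℕ)
    (k : {v : Fin D → Option M // deg v = e} → L) :
    {v : Fin D → Option (M ⊕ N) // deg v = e} → L :=
  fun v => if h : ∀ i b, v.1 i ≠ some (Sum.inr b)
    then k ⟨collapse v.1, (deg_collapse_of_pure h).trans v.2⟩ else p₀ (collapse v.1)

/-- The right side does not involve `Γ`, so the many derivatives of `p` share one leading part. -/
theorem leading_derive (Γ : Set N) (hp : IsRelDeg p p₀ e) :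
    leading e (derive p₀ Γ p) = liftLeading N p₀ e (leading e p) := by
  funext v
  unfold liftLeading
  split_ifs with h
  · exact derive_of_pure _ _ _ h
  · push Not at h
    obtain ⟨i, b, hb⟩ := h
    exact derive_of_not_pure Γ hp v.2 hb

theorem isRelDeg_derive_of_lt (Γ Γ₁ : Set N) (hp : IsRelDeg p p₀ e) (hp₁ : IsRelDeg p₁ p₀ e₁)
    (h : e₁ < e) : IsRelDeg (derive p₀ Γ p) (derive p₀ Γ₁ p₁) e := by
  refine ⟨?_, fun v hv => ?_⟩
  · obtain ⟨v, hv, hne⟩ := hp.1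
    refine ⟨lift N v, (deg_lift v).trans hv, ?_⟩
    rw [derive_of_pure _ _ _ (lift_pure v), derive_of_pure _ _ _ (lift_pure v), collapse_lift,
      hp₁.2 v (hv ▸ h)]
    exact hne
  · rw [derive_of_lt_deg Γ hp hv, derive_of_lt_deg Γ₁ hp₁ (h.trans hv)]

theorem weight_derivedSystem_lt [Finite M] [Finite L]
    {𝒜 : Set ((Fin D → Option M) → L)} (hp₁ : p₁ ∈ 𝒜) (h₁ : IsRelDeg p₁ p₀ e₁)
    (hmin : ∀ p ∈ 𝒜, ∀ e, IsRelDeg p p₀ e → e₁ ≤ e) :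
    WeightLT (weight (derivedSystem N p₀ 𝒜) (derive p₀ ∅ p₁)) (weight 𝒜 p₀) := by
  -- From degree `e₁` upwards, changing the reference creates no new leading part: each comes from a
  -- member of `𝒜` of the same relative degree.
  have key : ∀ r ∈ derivedSystem N p₀ 𝒜, ∀ e, e₁ ≤ e → IsRelDeg r (derive p₀ ∅ p₁) e →
      ∃ p ∈ 𝒜, IsRelDeg p p₀ e ∧ leading e r = liftLeading N p₀ e (leading e p) := by
    rintro _ ⟨Γ, p, hp, hne, rfl⟩ e he hr
    obtain ⟨e', he'⟩ := exists_isRelDeg hne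
    have hee : e = e' := by
      rcases (hmin p hp e' he').lt_or_eq with hlt | rfl
      · exact hr.eq (isRelDeg_derive_of_lt Γ ∅ he' h₁ hlt)
      · refine le_antisymm ?_ he
        by_contra hlt
        obtain ⟨v, rfl, hv⟩ := hr.1
        exact hv (by rw [derive_of_lt_deg _ he' (not_le.mp hlt),
          derive_of_lt_deg _ h₁ (not_le.mp hlt)])
    subst hee
    exact ⟨p, hp, he', leading_derive Γ he'⟩
  refine weightLT_of_le ⟨e₁, Nat.lt_succ_of_le h₁.le⟩ (fun j hj => ?_) ?_
  · refine (Set.ncard_le_ncard ?_ (Set.toFinite (liftLeading N p₀ (j : ℕ) '' _))).trans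
      (Set.ncard_image_le (Set.toFinite _))
    rintro _ ⟨r, ⟨hr, hrd⟩, rfl⟩
    obtain ⟨p, hp, hpd, hl⟩ := key r hr j (Fin.lt_def.mp hj).le hrd
    exact ⟨_, ⟨p, ⟨hp, hpd⟩, rfl⟩, hl.symm⟩
  · have hmem : leading e₁ p₁ ∈ leading e₁ '' {p ∈ 𝒜 | IsRelDeg p p₀ e₁} :=
      ⟨p₁, ⟨hp₁, h₁⟩, rfl⟩
    -- In degree `e₁` the class of `p₁` is lost: a derivative with that leading part agrees with the
    -- new reference there.
    refine lt_of_le_of_lt ?_ (Set.ncard_sdiff_singleton_lt_of_mem hmem (Set.toFinite _))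
    refine (Set.ncard_le_ncard ?_ (Set.toFinite (liftLeading N p₀ e₁ '' _))).trans
      (Set.ncard_image_le (Set.toFinite _))
    rintro _ ⟨r, ⟨hr, hrd⟩, rfl⟩
    obtain ⟨p, hp, hpd, hl⟩ := key r hr e₁ le_rfl hrd
    refine ⟨_, ⟨⟨p, ⟨hp, hpd⟩, rfl⟩, fun heq => ?_⟩, hl.symm⟩
    obtain ⟨v, hv, hne⟩ := hrd.1
    rw [Set.mem_singleton_iff] at heq
    rw [heq, ← leading_derive ∅ h₁] at hl
    exact hne (congrFun hl ⟨v, hv⟩)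

end Weight

/-! ### Gluing words -/

open Classical in
/-- The word equal to `u` on positions with letters in `A` only, and to `w` elsewhere. -/
noncomputable def glue (u : (Fin D → A) → L) (w : (Fin D → A ⊕ B) → L) : (Fin D → A ⊕ B) → L :=
  fun s => if h : ∃ r : Fin D → A, s = fun i => Sum.inl (r i) then u h.choose else w s

theorem glue_inl (u : (Fin D → A) → L) (w : (Fin D → A ⊕ B) → L) (r : Fin D → A) :
    glue u w (fun i => Sum.inl (r i)) = u r := by
  have h : ∃ r' : Fin D → A, (fun i => (Sum.inl (r i) : A ⊕ B)) = fun i => Sum.inl (r' i) :=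
    ⟨r, rfl⟩
  unfold glue
  rw [dif_pos h]
  congr 1
  funext i
  exact (Sum.inl_injective (congrFun h.choose_spec i)).symm

theorem glue_of_inr (u : (Fin D → A) → L) (w : (Fin D → A ⊕ B) → L) {s : Fin D → A ⊕ B}
    {i : Fin D} {b : B} (h : s i = Sum.inr b) : glue u w s = w s := by
  refine dif_neg ?_
  rintro ⟨r, rfl⟩
  simp at h

/-- Words over `(M ⊕ N) ⊕ B` as words over `M ⊕ (N ⊕ B)`. -/
def assoc (w : (Fin D → (M ⊕ N) ⊕ B) → L) : (Fin D → M ⊕ (N ⊕ B)) → L :=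
  fun s => w fun i => (Equiv.sumAssoc M N B).symm (s i)

theorem exists_inl_or_inr (s : Fin D → A ⊕ B) :
    (∃ r : Fin D → A, s = fun i => Sum.inl (r i)) ∨ ∃ i b, s i = Sum.inr b := by
  by_cases h : ∃ i b, s i = Sum.inr b
  · exact Or.inr h
  · push Not at h
    have : ∀ i, ∃ a, s i = Sum.inl a := fun i => by
      rcases hs : s i with a | b
      · exact ⟨a, rfl⟩
      · exact absurd hs (h i b)
    choose r hr using this
    exact Or.inl ⟨r, funext hr⟩

/-- Overwriting at `n ⊆ N` affects only the positions without letters in `B`. -/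
theorem overwrite_assoc_glue_inl (p : (Fin D → Option M) → L) (n : Set N)
    (u : (Fin D → M ⊕ N) → L) (w : (Fin D → (M ⊕ N) ⊕ B) → L) :
    overwrite p (Sum.inl '' n) (assoc (glue u w)) = assoc (glue (overwrite p n u) w) := by
  classical
  funext s
  obtain ⟨s, rfl⟩ : ∃ s', s = fun i => Equiv.sumAssoc M N B (s' i) :=
    ⟨fun i => (Equiv.sumAssoc M N B).symm (s i), by simp⟩
  rcases exists_inl_or_inr s with ⟨r, rfl⟩ | ⟨i, b, hb⟩
  · simp only [assoc, Equiv.symm_apply_apply, glue_inl, overwrite]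
    refine ite_congr (propext ⟨?_, ?_⟩) (fun _ => ?_) fun _ => rfl
    · rintro ⟨⟨i, b, hi⟩, h⟩
      refine ⟨⟨i, ?_⟩, fun j c hj => ?_⟩
      · rcases hr : r i with m | c
        · simp [hr] at hi
        · exact ⟨c, rfl⟩
      · simpa using h j (Sum.inl c) (by simp [hj])
    · rintro ⟨⟨i, b, hi⟩, h⟩
      refine ⟨⟨i, Sum.inl b, by simp [hi]⟩, fun j c hj => ?_⟩
      rcases hr : r j with m | c'
      · simp [hr] at hj
      · have := h j c' hr
        simp only [hr, Equiv.sumAssoc_apply_inl_inr, Sum.inr.injEq] at hj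
        exact ⟨c', this, hj⟩
    · congr 1
      funext i
      rcases hr : r i with m | c <;> simp [erase, hr]
  · have h₁ : assoc (glue (overwrite p n u) w) (fun i => Equiv.sumAssoc M N B (s i)) =
        assoc (glue u w) (fun i => Equiv.sumAssoc M N B (s i)) := by
      simp only [assoc, Equiv.symm_apply_apply]
      rw [glue_of_inr _ _ hb, glue_of_inr _ _ hb]
    rw [h₁]
    refine if_neg ?_
    rintro ⟨-, h⟩
    simpa using h i (Sum.inr b) (by simp [hb])

/-- Overwriting at `Γ ∪ γ`, where `Γ ⊆ N` and `γ ⊆ B`, in terms of derived polynomials. -/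
theorem overwrite_assoc_glue (p₀ p : (Fin D → Option M) → L) (Γ : Set N) (γ : Set B)
    (u : (Fin D → M ⊕ N) → L) (w : (Fin D → (M ⊕ N) ⊕ B) → L) :
    overwrite p (Sum.inl '' Γ ∪ Sum.inr '' γ) (assoc (glue u (overwrite (derive p₀ ∅ p₀) γ w))) =
      assoc (glue (overwrite p Γ u) (overwrite (derive p₀ Γ p) γ w)) := by
  classical
  funext s
  rcases exists_inl_or_inr (fun i => (Equiv.sumAssoc M N B).symm (s i)) with ⟨r, hr⟩ | ⟨i, b, hb⟩
  · rw [← overwrite_assoc_glue_inl]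
    have hs : ∀ i b, s i ≠ Sum.inr (Sum.inr b) := fun i b hi => by
      simpa [hi] using congrFun hr i
    simp only [overwrite, assoc, hr, glue_inl]
    refine ite_congr (propext (and_congr_right fun _ => forall₃_congr fun i c hc => ?_))
      (fun _ => rfl) fun _ => rfl
    rcases c with c | c
    · simp
    · exact absurd hc (hs i c)
  · have hs : s i = Sum.inr (Sum.inr b) := by
      simpa using (Equiv.symm_apply_eq _).mp hb
    have her : collapse (erase fun i => (Equiv.sumAssoc M N B).symm (s i)) = erase s := by
      funext j
      rcases hj : s j with m | c | c <;> simp [collapse, erase, hj]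
    have hΓ : (∀ i b, erase (fun i => (Equiv.sumAssoc M N B).symm (s i)) i = some (Sum.inr b) →
        b ∈ Γ) ↔ ∀ i b, s i = Sum.inr (Sum.inl b) → b ∈ Γ := by
      refine forall₂_congr fun j c => ?_
      rcases hj : s j with m | c' | c' <;> simp [erase, hj]
    have hγ : (∀ i b, (Equiv.sumAssoc M N B).symm (s i) = Sum.inr b → b ∈ γ) ↔
        ∀ i b, s i = Sum.inr (Sum.inr b) → b ∈ γ := by
      refine forall₂_congr fun j c => ?_
      rcases hj : s j with m | c' | c' <;> simp
    have hΓγ : (∀ i b, s i = Sum.inr b → b ∈ Sum.inl '' Γ ∪ Sum.inr '' γ) ↔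
        (∀ i b, s i = Sum.inr (Sum.inl b) → b ∈ Γ) ∧
          ∀ i b, s i = Sum.inr (Sum.inr b) → b ∈ γ := by
      constructor
      · exact fun h => ⟨fun j c hj => by simpa using h j _ hj, fun j c hj => by simpa using h j _ hj⟩
      · rintro ⟨h₁, h₂⟩ j (c | c) hj
        · exact Or.inl ⟨c, h₁ j c hj, rfl⟩
        · exact Or.inr ⟨c, h₂ j c hj, rfl⟩
    have h₁ : ∃ i b, s i = Sum.inr b := ⟨i, _, hs⟩
    have h₂ : ∃ i b, (Equiv.sumAssoc M N B).symm (s i) = Sum.inr b := ⟨i, b, hb⟩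
    simp only [overwrite, assoc]
    -- With a letter from `B` present, letters in `Γ` and `γ` lead to the value of `p`. If the
    -- `B`-letters lie in `γ` but some `N`-letter is outside `Γ`, the earlier value of `p₀`
    -- survives, which is the second branch of `derive`.
    rw [glue_of_inr _ _ hb, glue_of_inr _ _ hb, derive_self]
    simp only [overwrite, h₁, h₂, true_and, hγ, hΓγ, her, derive, hΓ]
    split_ifs <;> tauto

/-! ### The polynomial Hales–Jewett theorem -/

/-- A coloring of words has a monochromatic polynomial family. -/
def HasMono {K : Type*} (p₀ : (Fin D → Option M) → L) (𝒜 : Set ((Fin D → Option M) → L))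
    (ω : ((Fin D → M ⊕ N) → L) → K) : Prop :=
  ∃ (w : (Fin D → M ⊕ N) → L) (n : Set N), n.Nonempty ∧
    ∀ p ∈ 𝒜, ω (overwrite p n w) = ω (overwrite p₀ n w)

/-- The colors in `C` are focused at the word `y`. -/
def IsFocused {K : Type*} (p₀ : (Fin D → Option M) → L) (𝒜 : Set ((Fin D → Option M) → L))
    (ω : ((Fin D → M ⊕ N) → L) → K) (y : (Fin D → M ⊕ N) → L) (C : Finset K) : Prop :=
  ∀ c ∈ C, ∃ Γ : Set N, Γ.Nonempty ∧ overwrite p₀ Γ y = y ∧ ∀ p ∈ 𝒜, ω (overwrite p Γ y) = c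

/-- A solution for the derived system yields one more focused color. -/
theorem hasMono_or_isFocused_succ {K : Type*} {p₀ : (Fin D → Option M) → L}
    {𝒜 : Set ((Fin D → Option M) → L)} (hp₀ : p₀ ∉ 𝒜) {t : ℕ}
    (hN : ∀ ω : ((Fin D → M ⊕ N) → L) → K,
      HasMono p₀ 𝒜 ω ∨ ∃ y C, C.card = t ∧ IsFocused p₀ 𝒜 ω y C)
    (r : (Fin D → Option (M ⊕ N)) → L)
    (hB : ∀ ω : ((Fin D → (M ⊕ N) ⊕ B) → L) → ((Fin D → M ⊕ N) → L) → K,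
      HasMono r (derivedSystem N p₀ 𝒜) ω)
    (ω : ((Fin D → M ⊕ (N ⊕ B)) → L) → K) :
    HasMono p₀ 𝒜 ω ∨ ∃ y C, C.card = t + 1 ∧ IsFocused p₀ 𝒜 ω y C := by
  classical
  -- The color of `w` is a whole function of `u`, so a single `γ` works for all `u` at once.
  obtain ⟨w, γ, hγ, hw⟩ := hB fun w u => ω (assoc (glue u w))
  set ω' : ((Fin D → M ⊕ N) → L) → K := fun u => ω (assoc (glue u (overwrite r γ w))) with hω'
  have hcol : ∀ (Γ : Set N), ∀ p ∈ 𝒜, ∀ u,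
      ω (assoc (glue u (overwrite (derive p₀ Γ p) γ w))) = ω' u := fun Γ p hp u =>
    congrFun (hw _ ⟨Γ, p, hp, fun h => hp₀ (h ▸ hp), rfl⟩) u
  have transfer : HasMono p₀ 𝒜 ω' → HasMono p₀ 𝒜 ω := by
    rintro ⟨u, n, hn, hu⟩
    refine ⟨assoc (glue u (overwrite r γ w)), Sum.inl '' n, hn.image _, fun p hp => ?_⟩
    rw [overwrite_assoc_glue_inl, overwrite_assoc_glue_inl]
    exact hu p hp
  rcases hN ω' with h | ⟨y, C, hC, hy⟩
  · exact Or.inl (transfer h)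
  -- If the focus already has a focused color, it completes a monochromatic family; otherwise its
  -- color is new.
  by_cases hc : ω' y ∈ C
  · obtain ⟨Γ, hΓ, hΓy, hΓc⟩ := hy _ hc
    exact Or.inl (transfer ⟨y, Γ, hΓ, fun p hp => by rw [hΓc p hp, hΓy]⟩)
  have extend : ∀ Γ : Set N, overwrite p₀ Γ y = y → ∀ c, (∀ p ∈ 𝒜, ω' (overwrite p Γ y) = c) →
      ∃ Γ' : Set (N ⊕ B), Γ'.Nonempty ∧
        overwrite p₀ Γ' (assoc (glue y (overwrite (derive p₀ ∅ p₀) γ w))) =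
          assoc (glue y (overwrite (derive p₀ ∅ p₀) γ w)) ∧
        ∀ p ∈ 𝒜, ω (overwrite p Γ' (assoc (glue y (overwrite (derive p₀ ∅ p₀) γ w)))) = c := by
    intro Γ hΓ c hΓc
    refine ⟨Sum.inl '' Γ ∪ Sum.inr '' γ, (hγ.image _).inr, ?_, fun p hp => ?_⟩
    · rw [overwrite_assoc_glue, hΓ, derive_self, derive_self]
    · rw [overwrite_assoc_glue, hcol Γ p hp, hΓc p hp]
  refine Or.inr ⟨assoc (glue y (overwrite (derive p₀ ∅ p₀) γ w)), insert (ω' y) C,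
    by rw [Finset.card_insert_of_notMem hc, hC], fun c hcC => ?_⟩
  -- The new color is reached by `γ` alone, the old ones by `Γ ∪ γ`.
  rcases Finset.mem_insert.mp hcC with rfl | hcC
  · exact extend ∅ (overwrite_empty _ _) _ fun p _ => by rw [overwrite_empty]
  · obtain ⟨Γ, -, hΓy, hΓc⟩ := hy c hcC
    exact extend Γ hΓy c hΓc

/-- The polynomial Hales–Jewett theorem for words: for every finite system of polynomials and
every finite set of colors there is a finite `N` such that every coloring of the words over
`M ⊕ N` has a monochromatic polynomial family. -/
theorem exists_hasMono {L : Type} [Finite L] (M : Type u) [Finite M]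
    (p₀ : (Fin D → Option M) → L) (𝒜 : Set ((Fin D → Option M) → L)) (K : Type u) [Finite K] :
    ∃ N : Type u, Finite N ∧ ∀ ω : ((Fin D → M ⊕ N) → L) → K, HasMono p₀ 𝒜 ω := by
  induction hwt : weight 𝒜 p₀ using wellFounded_weightLT.induction generalizing M K with
  | _ x ih =>
  subst hwt
  have hL : Nonempty L := ⟨p₀ fun _ => none⟩
  by_cases hne : ∃ p ∈ 𝒜, p ≠ p₀
  swap
  · push Not at hne
    refine ⟨PUnit, inferInstance, fun ω => ⟨fun _ => hL.some, Set.univ, Set.univ_nonempty, ?_⟩⟩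
    intro p hp
    rw [hne p hp]
  have hex : ∃ e, ∃ p ∈ 𝒜, IsRelDeg p p₀ e := by
    obtain ⟨p, hp, hpne⟩ := hne
    obtain ⟨e, he⟩ := exists_isRelDeg hpne
    exact ⟨e, p, hp, he⟩
  classical
  obtain ⟨p₁, hp₁, h₁⟩ := Nat.find_spec hex
  have hmin : ∀ p ∈ 𝒜, ∀ e, IsRelDeg p p₀ e → Nat.find hex ≤ e :=
    fun p hp e he => Nat.find_min' hex ⟨p, hp, he⟩
  have focus : ∀ t : ℕ, ∃ N : Type u, Finite N ∧ ∀ ω : ((Fin D → M ⊕ N) → L) → K,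
      HasMono p₀ (𝒜 \ {p₀}) ω ∨ ∃ y C, C.card = t ∧ IsFocused p₀ (𝒜 \ {p₀}) ω y C := by
    intro t
    induction t with
    | zero =>
      exact ⟨PEmpty, inferInstance, fun ω =>
        Or.inr ⟨fun _ => hL.some, ∅, rfl, fun c hc => absurd hc (Finset.notMem_empty c)⟩⟩
    | succ t iht =>
      obtain ⟨N, hNfin, hN⟩ := iht
      obtain ⟨B, hBfin, hB⟩ := ih _ (weight_derivedSystem_lt (N := N) hp₁ h₁ hmin) (M ⊕ N)
        _ _ (((Fin D → M ⊕ N) → L) → K) rfl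
      refine ⟨N ⊕ B, inferInstance, hasMono_or_isFocused_succ (by simp) hN (derive p₀ ∅ p₁) fun ω => ?_⟩
      obtain ⟨w, n, hn, h⟩ := hB ω
      refine ⟨w, n, hn, ?_⟩
      rintro _ ⟨Γ, p, hp, hpne, rfl⟩
      exact h _ ⟨Γ, p, hp.1, hpne, rfl⟩
  have := Fintype.ofFinite K
  -- One more focused color than there are colors, so only the monochromatic alternative remains.
  obtain ⟨N, hNfin, hN⟩ := focus (Fintype.card K + 1)
  refine ⟨N, hNfin, fun ω => ?_⟩
  rcases hN ω with ⟨w, n, hn, h⟩ | ⟨y, C, hC, -⟩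
  · refine ⟨w, n, hn, fun p hp => ?_⟩
    by_cases hpp : p = p₀
    · rw [hpp]
    · exact h p ⟨hp, hpp⟩
  · have := Finset.card_le_univ C
    omega

end PolyHJ

/-! ### Set-polynomials -/

namespace SetPolynomial

variable {S : Type u} {D : ℕ}

theorem eval_mono (P : SetPolynomial S D) {m n : Finset S} (h : m ⊆ n) : P.eval m ⊆ P.eval n := by
  intro s hs
  rw [mem_eval] at hs ⊢
  obtain ⟨α, h₁, h₂⟩ := hs
  exact ⟨α, h₁, fun i hi => h (h₂ i hi)⟩

open Classical in
/-- The letters occurring in the coefficients of a set-polynomial. -/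
noncomputable def support (P : SetPolynomial S D) : Finset S :=
  Finset.univ.biUnion fun α => (P.coeff α).biUnion fun c => Finset.univ.image c

theorem mem_support (P : SetPolynomial S D) {α : Finset (Fin D)} {c : {i : Fin D // i ∉ α} → S}
    (hc : c ∈ P.coeff α) (i : {i : Fin D // i ∉ α}) : c i ∈ P.support := by
  simp only [support, Finset.mem_biUnion, Finset.mem_univ, true_and, Finset.mem_image]
  exact ⟨α, c, hc, i, rfl⟩

open Classical in
/-- The polynomial on words over `{true, false}` given by a set-polynomial. -/
noncomputable def toWord (P : SetPolynomial S D) (M : Finset S) : (Fin D → Option M) → Bool :=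
  fun v => decide (∃ α : Finset (Fin D), (∀ i ∈ α, v i = none) ∧
    ∃ c ∈ P.coeff α, ∀ i : {i : Fin D // i ∉ α}, (v i).map Subtype.val = some (c i))

section Word

variable {M : Finset S} {N : Type u} (ι : N ↪ S)

/-- Positions over `M ⊕ N` as points of `S ^ D`. -/
def point (s : Fin D → M ⊕ N) : Fin D → S := fun i => (s i).elim Subtype.val ι

theorem point_injective (hι : ∀ b, ι b ∉ M) : Function.Injective (point (D := D) (M := M) ι) := by
  intro s t h
  funext i
  have hi := congrFun h i
  simp only [point] at hi
  rcases hs : s i with m | b <;> rcases ht : t i with m' | b' <;> rw [hs, ht] at hi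
  · exact congrArg _ (Subtype.ext hi)
  · exact absurd (Eq.subst (motive := (· ∈ M)) hi m.2) (hι b')
  · exact absurd (Eq.subst (motive := (· ∈ M)) hi.symm m'.2) (hι b)
  · exact congrArg _ (ι.injective hi)

/-- The points of `P(n)` are the positions where the word polynomial writes `true`. -/
theorem mem_eval_map_iff {P : SetPolynomial S D} (hP : P.HasEmptyConstantTerm)
    (hM : P.support ⊆ M) (n : Finset N) (x : Fin D → S) :
    x ∈ P.eval (n.map ι) ↔ ∃ s : Fin D → M ⊕ N, point ι s = x ∧
      ((∃ i b, s i = Sum.inr b) ∧ ∀ i b, s i = Sum.inr b → b ∈ n) ∧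
      P.toWord M (PolyHJ.erase s) = true := by
  classical
  simp only [mem_eval, toWord, decide_eq_true_eq]
  constructor
  · rintro ⟨α, hc, hα⟩
    have hb : ∀ i : α, ∃ b ∈ n, ι b = x i := fun i => by simpa using hα i i.2
    choose b hbn hbx using hb
    have hs : ∀ i, ((if h : i ∈ α then Sum.inr (b ⟨i, h⟩)
        else Sum.inl ⟨x i, hM (P.mem_support hc ⟨i, h⟩)⟩ : M ⊕ N)).elim Subtype.val ι = x i := by
      intro i
      split_ifs with h
      · exact hbx ⟨i, h⟩
      · rfl
    refine ⟨fun i => if h : i ∈ α then Sum.inr (b ⟨i, h⟩)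
        else Sum.inl ⟨x i, hM (P.mem_support hc ⟨i, h⟩)⟩, funext hs, ⟨?_, fun i c hi => ?_⟩,
      α, fun i hi => by simp [PolyHJ.erase, hi], _, hc, fun i => by simp [PolyHJ.erase, i.2]⟩
    -- A constant term would give points without letters of `n`, which overwriting never touches.
    · obtain ⟨i, hi⟩ : α.Nonempty := by
        rw [Finset.nonempty_iff_ne_empty]
        rintro rfl
        rw [show P.coeff ∅ = ∅ from hP] at hc
        exact Finset.notMem_empty _ hc
      exact ⟨i, b ⟨i, hi⟩, dif_pos hi⟩
    · by_cases h : i ∈ α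
      · simp only [h, dite_true, Sum.inr.injEq] at hi
        exact hi ▸ hbn _
      · simp [h] at hi
  · rintro ⟨s, rfl, ⟨-, hn⟩, α, hα, c, hc, hci⟩
    refine ⟨α, ?_, fun i hi => ?_⟩
    · convert hc using 1
      funext i
      have := hci i
      rcases hs : s i with m | b <;> simp_all [PolyHJ.erase, point]
    · have := hα i hi
      rcases hs : s i with m | b
      · simp [PolyHJ.erase, hs] at this
      · simpa [point, hs] using hn i b hs

end Word

/-- A finite type embeds into the complement of a finite subset of an infinite type. -/
theorem exists_embedding_notMem [Infinite S] (M : Finset S) (N : Type*) [Finite N] :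
    ∃ ι : N ↪ S, ∀ b, ι b ∉ M := by
  obtain ⟨m, ⟨e⟩⟩ := Finite.exists_equiv_fin N
  have : Infinite {x // x ∉ M} := M.finite_toSet.infinite_compl.to_subtype
  exact ⟨(e.toEmbedding.trans Fin.valEmbedding).trans ((Infinite.natEmbedding _).trans
    (Function.Embedding.subtype (· ∉ M))), fun b => (Infinite.natEmbedding {x // x ∉ M} (e b)).2⟩

/-- The chromatic form of the recurrence of systems of set-polynomials. -/
theorem isColoringRecurrent [Infinite S] (A : Finset (SetPolynomial S D))
    (hA : ∀ P ∈ A, P.HasEmptyConstantTerm) : IsColoringRecurrent A := by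
  classical
  intro k H
  -- Including `H` among the constants keeps the new letters away from it.
  set M : Finset S := H ∪ A.biUnion support with hMdef
  obtain ⟨N, hNfin, hN⟩ := PolyHJ.exists_hasMono (D := D) M (fun _ => false)
    {p | ∃ P ∈ A, p = P.toWord M} (ULift.{u} (Fin k))
  have := Fintype.ofFinite N
  obtain ⟨ι, hι⟩ := exists_embedding_notMem M N
  set U : Finset (Fin D → S) := A.biUnion fun P => P.eval (Finset.univ.map ι) with hU
  -- Cutting down to `U` secures the bound on `a` and loses nothing of `P(n)`.
  set toSet : ((Fin D → M ⊕ N) → Bool) → Finset (Fin D → S) := fun w =>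
    (Finset.univ.filter fun s => w s = true).image (point ι) ∩ U with hSet
  have hinj := point_injective (D := D) (M := M) ι hι
  refine ⟨Finset.univ.map ι, ?_, fun ω => ?_⟩
  · rw [Finset.disjoint_left]
    intro x hx hxH
    obtain ⟨b, -, rfl⟩ := Finset.mem_map.mp hx
    exact hι b (Finset.mem_union_left _ hxH)
  obtain ⟨w, n, hn, hw⟩ := hN fun w => ⟨ω (toSet w)⟩
  have hsub : n.toFinset.map ι ⊆ Finset.univ.map ι := Finset.map_subset_map.mpr (by simp)
  refine ⟨n.toFinset.map ι, hsub, by simpa using hn, toSet (PolyHJ.overwrite (fun _ => false) n w),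
    Finset.inter_subset_right, fun P hP => ?_⟩
  have hPM : P.support ⊆ M :=
    (Finset.subset_biUnion_of_mem support hP).trans Finset.subset_union_right
  have hmem := mem_eval_map_iff ι (hA P hP) hPM n.toFinset
  have hPU : P.eval (n.toFinset.map ι) ⊆ U :=
    (P.eval_mono hsub).trans (Finset.subset_biUnion_of_mem
      (fun P => P.eval (Finset.univ.map ι)) hP)
  constructor
  · rw [Finset.disjoint_left]
    intro x hx hxP
    obtain ⟨s, hs, ⟨h₁, h₂⟩, -⟩ := (hmem x).mp hxP
    obtain ⟨s', hs', rfl⟩ := Finset.mem_image.mp (Finset.mem_inter.mp hx).1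
    obtain rfl := hinj hs
    rw [Finset.mem_filter, PolyHJ.overwrite, if_pos ⟨h₁, by simpa using h₂⟩] at hs'
    exact Bool.false_ne_true hs'.2
  · have heq : toSet (PolyHJ.overwrite (fun _ => false) n w) ∪ P.eval (n.toFinset.map ι) =
        toSet (PolyHJ.overwrite (P.toWord M) n w) := by
      ext x
      simp only [hSet, Finset.mem_union, Finset.mem_inter, Finset.mem_image, Finset.mem_filter,
        Finset.mem_univ, true_and]
      constructor
      · rintro (⟨⟨s, hs, rfl⟩, hx⟩ | hx)
        · refine ⟨⟨s, ?_, rfl⟩, hx⟩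
          unfold PolyHJ.overwrite at hs ⊢
          split_ifs at hs ⊢
          exact hs
        · refine ⟨?_, hPU hx⟩
          obtain ⟨s, hs, ⟨h₁, h₂⟩, h₃⟩ := (hmem x).mp hx
          exact ⟨s, (if_pos ⟨h₁, by simpa using h₂⟩).trans h₃, hs⟩
      · rintro ⟨⟨s, hs, rfl⟩, hx⟩
        unfold PolyHJ.overwrite at hs
        split_ifs at hs with h
        · exact Or.inr ((hmem _).mpr ⟨s, rfl, ⟨h.1, by simpa using h.2⟩, hs⟩)
        · exact Or.inl ⟨⟨s, by rwa [PolyHJ.overwrite, if_neg h], rfl⟩, hx⟩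
    have := congrArg ULift.down (hw _ ⟨P, hP, rfl⟩)
    convert this using 2

end SetPolynomial

/-- The chromatic form of recurrence implies the topological form. -/
theorem IsColoringRecurrent.isSystemOfRecurrence {S : Type u} {D : ℕ}
    {A : Finset (SetPolynomial S D)} (h : IsColoringRecurrent A) :
    IsSystemOfRecurrence.{u, v} A := by
  classical
  intro X _ _ T ε hε H
  obtain ⟨t, -, htfin, ht⟩ :=
    (isCompact_univ (X := X)).finite_cover_balls (half_pos hε)
  have := htfin.fintype
  -- The number of balls depends on `X` and `ε` only, so `N` is chosen before `x`.
  obtain ⟨N, hN, hcol⟩ := h (Fintype.card t) H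
  refine ⟨N, hN, fun x => ?_⟩
  have hcov : ∀ y : X, ∃ c : t, dist y c < ε / 2 := fun y => by
    obtain ⟨c, hc, hy⟩ := Set.mem_iUnion₂.mp (ht (Set.mem_univ y))
    exact ⟨⟨c, hc⟩, hy⟩
  choose f hf using hcov
  obtain ⟨n, hn, hne, a, ha, hP⟩ := hcol fun a => Fintype.equivFin t (f (T.act a x))
  refine ⟨n, hn, hne, a, ha, fun P hPA => ⟨(hP P hPA).1, ?_⟩⟩
  have heq := (Fintype.equivFin t).injective (hP P hPA).2
  have h₁ := hf (T.act a x)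
  rw [← heq] at h₁
  have h₂ := hf (T.act (a ∪ P.eval n) x)
  have := dist_triangle_right (T.act (a ∪ P.eval n) x) (T.act a x)
    (f (T.act (a ∪ P.eval n) x) : X)
  linarith

theorem theorem3p4 {S : Type u} [Infinite S] {D : ℕ} (hD : 0 < D)
    (A : Finset (SetPolynomial S D)) (hA : ∀ P ∈ A, P.HasEmptyConstantTerm) :
    IsSystemOfRecurrence.{u, v} A ∧ IsColoringRecurrent A :=
  have h := SetPolynomial.isColoringRecurrent A hA
  ⟨h.isSystemOfRecurrence, h⟩
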